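/- Let $q$ be a prime power, let $t\ge 2$ be an integer with $q\ge t$, and put $\theta_s=(q^{s+1}-1)/(q-1)$. A $q$-order subline of $\mathrm{PG}(1,q^t)$ is a point set of the form $\{\langle w\rangle_{\mathbb F_{q^t}} : w\in W\setminus\{0\}\}$, where $W$ is a two-dimensional $\mathbb F_q$-subspace of $\mathbb F_{q^t}^2$ that spans $\mathbb F_{q^t}^2$ over $\mathbb F_{q^t}$. A linear set of pseudoregulus type in $\mathrm{PG}(1,q^t)$ is the image of $\{\langle(\lambda,\lambda^q)\rangle_{\mathbb F_{q^t}} : \lambda\in\mathbb F_{q^t}^*\}$ under a projectivity (an element of $\mathrm{PGL}(2,q^t)$). If $\mathbb L$ is a linear set of pseudoregulus type in $\mathrm{PG}(1,q^t)$, then the number of $q$-order sublines contained in $\mathbb L$ is $$\frac{\theta_{t-1}}{q+1}\left(\frac{\sum_{y\in\mathbb F_{q^t}\setminus\mathbb F_q}[\mathbb F_q(y):\mathbb F_q]}{q(q-1)}-\theta_{t-2}\right).$$ If, moreover, $t$ is prime, then this number equals $(t-1)\,\theta_{t-1}\theta_{t-2}/\theta_1$. -/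

import Mathlib

open scoped LinearAlgebra.Projectivization IntermediateField

/-- `theta q s = (q ^ (s + 1) - 1) / (q - 1)`, the number of points of `PG(s, q)`. -/
def theta (q s : ℕ) : ℚ := ((q : ℚ) ^ (s + 1) - 1) / ((q : ℚ) - 1)

/-- The set of points `⟨w⟩` of the projective space `ℙ K V`, for nonzero `w` in the
`F`-subspace `W` of `V`. -/
def pointsOf {F K V : Type*} [Field F] [Field K] [AddCommGroup V] [Module F V] [Module K V]
    (W : Submodule F V) : Set (ℙ K V) :=
  {P | ∃ (w : V) (hw : w ≠ 0), w ∈ W ∧ P = Projectivization.mk K w hw}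

/-- `S` is a canonical subgeometry of `PG(n - 1, K) = ℙ K V` over the subfield `F`:
the set of points defined by the nonzero vectors of an `F`-subspace `W` of `V` of dimension
`n = dim_K V` over `F`, and it spans the whole projective space. -/
def IsCanonicalSubgeometry (F : Type*) {K V : Type*} [Field F] [Field K] [AddCommGroup V]
    [Module F V] [Module K V] (S : Set (ℙ K V)) : Prop :=
  ∃ W : Submodule F V, Module.finrank F W = Module.finrank K V ∧
    Submodule.span K (W : Set V) = ⊤ ∧ S = pointsOf W

/-- A `q`-order subline of `PG(1, q ^ t)`, where `F` and `K` have orders `q` and `q ^ t`: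
a canonical subgeometry over `F` of the projective line over `K`. -/
def IsSubline (F : Type*) {K : Type*} [Field F] [Field K] [Algebra F K]
    (r : Set (ℙ K (Fin 2 → K))) : Prop :=
  IsCanonicalSubgeometry F r

/-- The point set `{⟨(x, x ^ q)⟩ | x ∈ K, x ≠ 0}` of the projective line over `K`. -/
def standardPseudoregulus (q : ℕ) (K : Type*) [Field K] : Set (ℙ K (Fin 2 → K)) :=
  {P | ∃ (x : K) (h : ![x, x ^ q] ≠ 0), x ≠ 0 ∧ P = Projectivization.mk K ![x, x ^ q] h}

/-- `L` is a linear set of pseudoregulus type in `PG(1, q ^ t)`, where `F` and `K` have orders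
`q` and `q ^ t`: it is the image of `{⟨(x, x ^ q)⟩ | x ≠ 0}` under a projectivity. -/
def IsPseudoregulusType (F : Type*) {K : Type*} [Field F] [Field K]
    (L : Set (ℙ K (Fin 2 → K))) : Prop :=
  ∃ g : (Fin 2 → K) ≃ₗ[K] (Fin 2 → K),
    L = Projectivization.map g.toLinearMap g.injective '' standardPseudoregulus (Nat.card F) K

/-! ### Norms over finite fields and conjugate elements. -/

section Norm

variable {F K : Type*} [Field F] [Field K] [Finite K] [Algebra F K]

/-! Write `Q = q ^ t`. Sublines are counted through the matrices in `GL₂(K)` whose columns span them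
over `F`. A projectivity acts on these matrices by left multiplication, so `L` may be taken
standard; by Hilbert 90 it then consists of the points `⟨(a, b)⟩` with `N(a) = N(b)`.

A matrix with columns `(a, c)` and `(a u, c v)` gives a subline inside `L` iff `N(a) = N(c)` and
`N(u + s) = N(v + s)` for all `s ∈ F`. Both norms are values of monic polynomials of degree `t ≤ q`,
so agreement at `q` points forces equality, that is, `u` and `v` are conjugate
(`norm_add_algebraMap_eq_iff`). Invertibility means `u ≠ v`. Hence there are `(Q - 1) · (Q - 1)/(q -
1) · ∑ ([F(u) : F] - 1)` such matrices (`frameSublineSubsetEquiv`).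

Each subline arises from `|Kˣ| |GL₂(F)| / |Fˣ| = (Q - 1) q (q² - 1)` matrices
(`ncard_frameSubline_eq`), and the quotient is the claimed number. For `t` prime, every element
outside `F` has degree `t`. -/

lemma card_sub_one_dvd_card_sub_one (F K : Type*) [Field F] [Field K] [Finite K] [Algebra F K] :
    Nat.card F - 1 ∣ Nat.card K - 1 := by
  have := Finite.of_injective _ (algebraMap F K).injective
  rw [Module.natCard_eq_pow_finrank (K := F) (V := K)]
  simpa using Nat.sub_dvd_pow_sub_pow (Nat.card F) 1 (Module.finrank F K)

lemma card_ker_unitsMap_norm (F K : Type*) [Field F] [Field K] [Finite K] [Algebra F K] :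
    Nat.card (Units.map (Algebra.norm F (S := K))).ker * (Nat.card F - 1) = Nat.card K - 1 := by
  have := Finite.of_injective _ (algebraMap F K).injective
  have h := (Units.map (Algebra.norm F (S := K))).ker.card_mul_index
  rw [Subgroup.index_ker, MonoidHom.range_eq_top.2 (FiniteField.unitsMap_norm_surjective F K),
    Subgroup.card_top, Nat.card_units, Nat.card_units] at h
  exact h

/-- Hilbert's theorem 90 for finite fields. -/
lemma ker_unitsMap_norm_eq_range (F K : Type*) [Field F] [Field K] [Finite K] [Algebra F K] :
    (powMonoidHom (Nat.card F - 1) : Kˣ →* Kˣ).range =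
      (Units.map (Algebra.norm F (S := K))).ker := by
  have := Finite.of_injective _ (algebraMap F K).injective
  have hF : 0 < Nat.card F - 1 := Nat.sub_pos_of_lt Finite.one_lt_card
  refine Subgroup.eq_of_le_of_card_ge ?_ ?_
  · rintro _ ⟨x, rfl⟩
    rw [MonoidHom.mem_ker, powMonoidHom_apply, map_pow, ← Nat.card_units, pow_card_eq_one']
  -- `Kˣ` is cyclic, so both subgroups have order `(Q - 1)/(q - 1)`.
  · rw [IsCyclic.card_powMonoidHom_range, Nat.card_units,
      Nat.gcd_eq_right (card_sub_one_dvd_card_sub_one F K), ← card_ker_unitsMap_norm F K,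
      Nat.mul_div_cancel _ hF]

lemma norm_eq_one_iff_exists_pow {z : K} (hz : z ≠ 0) :
    Algebra.norm F z = 1 ↔ ∃ x : K, x ≠ 0 ∧ x ^ (Nat.card F - 1) = z := by
  have h := SetLike.ext_iff.1 (ker_unitsMap_norm_eq_range F K) (Units.mk0 z hz)
  simp only [MonoidHom.mem_range, MonoidHom.mem_ker, powMonoidHom_apply, Units.ext_iff,
    Units.val_pow_eq_pow_val, Units.val_mk0, Units.coe_map, Units.val_one] at h
  rw [show Algebra.norm F z = 1 ↔ _ from h.symm]
  exact ⟨fun ⟨x, hx⟩ ↦ ⟨x, x.ne_zero, hx⟩, fun ⟨x, hx, h⟩ ↦ ⟨Units.mk0 x hx, h⟩⟩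

lemma ncard_norm_eq_norm {a : K} (ha : a ≠ 0) :
    {c : K | Algebra.norm F c = Algebra.norm F a}.ncard * (Nat.card F - 1) = Nat.card K - 1 := by
  have hna : Algebra.norm F a ≠ 0 := by rwa [Ne, Algebra.norm_eq_zero_iff]
  rw [← card_ker_unitsMap_norm F K, ← Nat.card_coe_set_eq]
  congr 1
  refine Nat.card_congr ?_
  refine
    { toFun := fun c ↦ ⟨Units.mk0 (c.1 / a) (div_ne_zero ?_ ha), ?_⟩
      invFun := fun u ↦ ⟨u.1 * a, ?_⟩
      left_inv := fun c ↦ ?_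
      right_inv := fun u ↦ ?_ }
  · intro h
    have := c.2
    simp only [h, Set.mem_ofPred_eq, Algebra.norm_zero] at this
    exact hna this.symm
  · rw [MonoidHom.mem_ker, Units.ext_iff]
    have := c.2
    simp only [Set.mem_ofPred_eq] at this
    change Algebra.norm F (c.1 / a) = 1
    rw [← mul_left_inj' hna, ← map_mul, div_mul_cancel₀ _ ha, this, one_mul]
  · have := u.2
    rw [MonoidHom.mem_ker, Units.ext_iff] at this
    simp only [Units.coe_map, Units.val_one] at this
    have h1 : Algebra.norm F (u.1 : K) = 1 := this
    simp [h1]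
  · ext; simp [ha]
  · ext; simp [ha]

/-- `N(u + s)` is the value at `s` of the monic polynomial `∏ (X + σ u)` over the Galois group, and
this polynomial determines `u` up to conjugacy. -/
lemma norm_add_algebraMap_eq_iff (hK : Module.finrank F K ≤ Nat.card F) {u v : K} :
    (∀ s : F, Algebra.norm F (u + algebraMap F K s) = Algebra.norm F (v + algebraMap F K s)) ↔
      IsConjRoot F u v := by
  have := Finite.of_injective _ (algebraMap F K).injective
  have := Fintype.ofFinite F
  rw [isConjRoot_iff_exists_algEquiv]
  constructor
  · intro h
    let P : K → Polynomial K := fun u ↦ ∏ σ : Gal(K/F), (Polynomial.X + Polynomial.C (σ u))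
    have hmonic (u : K) : (P u).Monic :=
      Polynomial.monic_prod_of_monic _ _ fun _ _ ↦ Polynomial.monic_X_add_C _
    have hdeg (u : K) : (P u).natDegree = Module.finrank F K := by
      rw [Polynomial.natDegree_prod_of_monic _ _ fun _ _ ↦ Polynomial.monic_X_add_C _]
      simp [← Nat.card_eq_fintype_card, IsGalois.card_aut_eq_finrank]
    have heval (u : K) (s : F) : (P u).eval (algebraMap F K s) =
        algebraMap F K (Algebra.norm F (u + algebraMap F K s)) := by
      simp [P, Polynomial.eval_prod, Algebra.norm_eq_prod_automorphisms, add_comm]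
    have hPP : P u = P v := by
      -- The leading terms cancel, so the difference has degree below `[K : F] ≤ |F|`; monicity is
      -- what makes `t = q` admissible.
      refine Polynomial.eq_of_degree_sub_lt_of_eval_index_eq (ι := F) Finset.univ
        (v := algebraMap F K) (algebraMap F K).injective.injOn ?_ fun s _ ↦ by
          rw [heval, heval, h]
      rw [Finset.card_univ, ← Nat.card_eq_fintype_card]
      refine (Polynomial.degree_sub_lt_left ?_ (hmonic u).ne_zero ?_).trans_le ?_
      · rw [Polynomial.degree_eq_natDegree (hmonic u).ne_zero,
          Polynomial.degree_eq_natDegree (hmonic v).ne_zero, hdeg, hdeg]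
      · rw [(hmonic u).leadingCoeff, (hmonic v).leadingCoeff]
      · rw [Polynomial.degree_eq_natDegree (hmonic u).ne_zero, hdeg]
        exact_mod_cast hK
    have h0 : (P v).eval (-u) = 0 := by
      rw [← hPP, Polynomial.eval_prod]
      exact Finset.prod_eq_zero (Finset.mem_univ 1) (by simp)
    rw [Polynomial.eval_prod, Finset.prod_eq_zero_iff] at h0
    obtain ⟨σ, -, hσ⟩ := h0
    exact ⟨σ, (neg_add_eq_zero.1 (by simpa using hσ)).symm⟩
  · rintro ⟨σ, rfl⟩ s
    rw [← Algebra.norm_eq_of_algEquiv σ (v + algebraMap F K s)]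
    simp

lemma ncard_isConjRoot (u : K) :
    {v : K | IsConjRoot F u v}.ncard = Module.finrank F F⟮u⟯ := by
  have := Finite.of_injective _ (algebraMap F K).injective
  have hu : IsIntegral F u := Algebra.IsIntegral.isIntegral u
  rw [IntermediateField.adjoin.finrank hu, ← Polynomial.card_rootSet_eq_natDegree
    (Algebra.IsSeparable.isSeparable F u) (Normal.splits inferInstance u),
    ← Nat.card_eq_fintype_card, ← Nat.card_coe_set_eq]
  congr
  ext v
  exact isConjRoot_iff_mem_minpoly_rootSet hu

end Norm

/-! ### Sublines as cosets in `GL₂(K)`. -/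

section Frame

variable {F K : Type*} [Field F] [Field K] [Algebra F K]

/-- The `F`-linear map `F² → K²` with matrix `g`. -/
def frameMap (F : Type*) {K : Type*} [Field F] [Field K] [Algebra F K] (g : GL (Fin 2) K) :
    (Fin 2 → F) →ₗ[F] (Fin 2 → K) :=
  (g.1.mulVecLin.restrictScalars F) ∘ₗ (Algebra.linearMap F K).compLeft (Fin 2)

/-- The `F`-subline spanned by the columns of `g`. -/
def frameSubline (F : Type*) {K : Type*} [Field F] [Field K] [Algebra F K] (g : GL (Fin 2) K) :
    Set (ℙ K (Fin 2 → K)) :=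
  pointsOf (LinearMap.range (frameMap F g))

lemma frameMap_apply (g : GL (Fin 2) K) (s : Fin 2 → F) :
    frameMap F g s = g.1.mulVec (algebraMap F K ∘ s) := rfl

lemma mulVec_injective_of_GL (g : GL (Fin 2) K) : Function.Injective g.1.mulVec :=
  Matrix.mulVec_injective_of_isUnit g.isUnit

lemma frameMap_injective (g : GL (Fin 2) K) : Function.Injective (frameMap F g) := by
  intro s s' h
  have := mulVec_injective_of_GL g h
  exact funext fun i ↦ (algebraMap F K).injective (congrFun this i)

lemma frameMap_mul (g h : GL (Fin 2) K) (s : Fin 2 → F) :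
    frameMap F (g * h) s = g.1.mulVec (frameMap F h s) := by
  rw [frameMap_apply, frameMap_apply, Matrix.mulVec_mulVec]
  rfl

lemma mk_mem_frameSubline {g : GL (Fin 2) K} {v : Fin 2 → K} (hv : v ≠ 0) :
    Projectivization.mk K v hv ∈ frameSubline F g ↔
      ∃ (s : Fin 2 → F) (k : K), v = k • frameMap F g s := by
  constructor
  · rintro ⟨w, hw, ⟨s, rfl⟩, h⟩
    obtain ⟨k, hk⟩ := (Projectivization.mk_eq_mk_iff' K _ _ _ _).1 h
    exact ⟨s, k, hk.symm⟩
  · rintro ⟨s, k, rfl⟩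
    have hs : frameMap F g s ≠ 0 := fun h ↦ hv (by rw [h, smul_zero])
    exact ⟨_, hs, ⟨s, rfl⟩, (Projectivization.mk_eq_mk_iff' K _ _ _ _).2 ⟨k, rfl⟩⟩

lemma frameSubline_subset_iff {g : GL (Fin 2) K} {S : Set (ℙ K (Fin 2 → K))} :
    frameSubline F g ⊆ S ↔
      ∀ (s : Fin 2 → F) (h : frameMap F g s ≠ 0), Projectivization.mk K _ h ∈ S := by
  constructor
  · exact fun h s hs ↦ h ⟨_, hs, ⟨s, rfl⟩, rfl⟩
  · rintro h _ ⟨_, hw, ⟨s, rfl⟩, rfl⟩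
    exact h s hw

lemma isSubline_iff_exists_frameSubline {r : Set (ℙ K (Fin 2 → K))} :
    IsSubline F r ↔ ∃ g : GL (Fin 2) K, frameSubline F g = r := by
  constructor
  · rintro ⟨W, hW, hspan, rfl⟩
    rw [Module.finrank_fin_fun] at hW
    have : Module.Finite F W := Module.finite_of_finrank_eq_succ hW
    let b := Module.finBasisOfFinrankEq F W hW
    have hWb : W = Submodule.span F (Set.range fun i ↦ (b i : Fin 2 → K)) := by
      have := congrArg (Submodule.map W.subtype) b.span_eq
      rw [Submodule.map_span, Submodule.map_top, Submodule.range_subtype, ← Set.range_comp] at this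
      exact this.symm
    have hspan' : ⊤ ≤ Submodule.span K (Set.range fun i ↦ (b i : Fin 2 → K)) := by
      rw [← hspan, Submodule.span_le]
      nth_rw 1 [hWb]
      exact Submodule.span_le_restrictScalars F K _
    have hli := linearIndependent_of_top_le_span_of_card_eq_finrank hspan' (by simp)
    let A : Matrix (Fin 2) (Fin 2) K := .of fun i j ↦ (b j : Fin 2 → K) i
    have hA : IsUnit A := Matrix.linearIndependent_cols_iff_isUnit.1 hli
    refine ⟨hA.unit, ?_⟩
    rw [frameSubline]
    congr 1
    rw [hWb]
    ext w
    rw [Submodule.mem_span_range_iff_exists_fun]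
    refine exists_congr fun s ↦ ?_
    rw [frameMap_apply, IsUnit.unit_spec]
    refine Eq.congr ?_ rfl
    ext i
    simp [A, Matrix.mulVec, dotProduct, Algebra.smul_def, mul_comm]
  · rintro ⟨g, rfl⟩
    refine ⟨LinearMap.range (frameMap F g), ?_, ?_, rfl⟩
    · rw [LinearMap.finrank_range_of_inj (frameMap_injective g), Module.finrank_fin_fun,
        Module.finrank_fin_fun]
    · rw [eq_top_iff]
      have hli := Matrix.linearIndependent_cols_iff_isUnit.2 g.isUnit
      rw [← hli.span_eq_top_of_card_eq_finrank' (by simp), Submodule.span_le]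
      rintro _ ⟨j, rfl⟩
      refine Submodule.subset_span ⟨Pi.single j 1, ?_⟩
      rw [frameMap_apply]
      have : algebraMap F K ∘ Pi.single j (1 : F) = Pi.single j (1 : K) := by
        ext i
        rcases eq_or_ne i j with rfl | h <;> simp [*]
      rw [this, Matrix.mulVec_single_one]

/-- The homomorphism `(k, m) ↦ k • m` to `GL₂(K)`. -/
def scaledMap (F K : Type*) [Field F] [Field K] [Algebra F K] :
    Kˣ × GL (Fin 2) F →* GL (Fin 2) K :=
  MonoidHom.noncommCoprod (Matrix.GeneralLinearGroup.scalar (Fin 2))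
    (Matrix.GeneralLinearGroup.map (algebraMap F K))
    fun u _ ↦ Matrix.GeneralLinearGroup.scalar_commute u _

lemma coe_scaledMap (k : Kˣ) (m : GL (Fin 2) F) :
    (scaledMap F K (k, m)).1 = (k : K) • m.1.map (algebraMap F K) := by
  change Matrix.scalar (Fin 2) (k : K) * m.1.map (algebraMap F K) = _
  rw [Matrix.scalar_apply, ← Matrix.smul_eq_diagonal_mul]

lemma frameMap_mul_scaledMap (g : GL (Fin 2) K) (k : Kˣ) (m : GL (Fin 2) F) (s : Fin 2 → F) :
    frameMap F (g * scaledMap F K (k, m)) s = (k : K) • frameMap F g (m.1.mulVec s) := by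
  rw [frameMap_mul, frameMap_apply, frameMap_apply, coe_scaledMap, Matrix.smul_mulVec,
    Matrix.mulVec_smul]
  congr 2
  ext i
  exact (RingHom.map_mulVec (algebraMap F K) m.1 s i).symm

lemma frameSubline_mul_scaledMap (g : GL (Fin 2) K) (x : Kˣ × GL (Fin 2) F) :
    frameSubline F (g * scaledMap F K x) = frameSubline F g := by
  have key (g : GL (Fin 2) K) (x : Kˣ × GL (Fin 2) F) :
      frameSubline F (g * scaledMap F K x) ⊆ frameSubline F g := by
    rw [frameSubline_subset_iff]
    intro s hs
    rw [mk_mem_frameSubline]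
    exact ⟨_, _, frameMap_mul_scaledMap g x.1 x.2 s⟩
  refine (key g x).antisymm ?_
  simpa [mul_assoc, ← map_mul] using key (g * scaledMap F K x) x⁻¹

/-- After cancelling `g`, `h` sends each `F`-vector to a `K`-multiple of an `F`-vector. The images
of `(1, 0)`, `(0, 1)` and their sum already force `h` to be a scalar times a matrix over `F`. -/
lemma mem_range_scaledMap_of_frameSubline_eq {g h : GL (Fin 2) K}
    (hgh : frameSubline F (g * h) = frameSubline F g) : h ∈ (scaledMap F K).range := by
  have key (s : Fin 2 → F) : ∃ (s' : Fin 2 → F) (k : K), ∀ i,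
      frameMap F h s i = k * algebraMap F K (s' i) := by
    rcases eq_or_ne s 0 with rfl | hs
    · exact ⟨0, 0, by simp⟩
    have h0 : frameMap F (g * h) s ≠ 0 := by
      rwa [Ne, map_eq_zero_iff _ (frameMap_injective _)]
    obtain ⟨s', k, hk⟩ := (mk_mem_frameSubline h0).1
      (hgh ▸ (mk_mem_frameSubline h0).2 ⟨s, 1, (one_smul _ _).symm⟩)
    refine ⟨s', k, fun i ↦ ?_⟩
    rw [frameMap_mul, frameMap_apply g, ← Matrix.mulVec_smul] at hk
    exact congrFun (mulVec_injective_of_GL g hk) i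
  have hdet : h.1.det ≠ 0 := Matrix.GeneralLinearGroup.det_ne_zero h
  obtain ⟨s₁, k₁, h₁⟩ := key ![1, 0]
  obtain ⟨s₂, k₂, h₂⟩ := key ![0, 1]
  obtain ⟨s₃, k₃, h₃⟩ := key ![1, 1]
  simp only [frameMap_apply, Matrix.mulVec, dotProduct, Fin.sum_univ_two, Function.comp_apply,
    Matrix.cons_val_zero, Matrix.cons_val_one, map_one, map_zero, mul_one, mul_zero, add_zero,
    zero_add] at h₁ h₂ h₃
  have h10 := h₁ 0
  have h11 := h₁ 1
  have h20 := h₂ 0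
  have h21 := h₂ 1
  have h30 := h₃ 0
  have h31 := h₃ 1
  rw [h10, h20] at h30
  rw [h11, h21] at h31
  rw [Matrix.det_fin_two, h10, h11, h20, h21] at hdet
  -- Cramer's rule for `k₁ s₁ + k₂ s₂ = k₃ s₃`: the columns of `h` become `(k₃ / D) x s₁` and `(k₃ /
  -- D) y s₂`.
  let D : F := s₁ 0 * s₂ 1 - s₁ 1 * s₂ 0
  let x : F := s₃ 0 * s₂ 1 - s₃ 1 * s₂ 0
  let y : F := s₁ 0 * s₃ 1 - s₁ 1 * s₃ 0
  have hx : k₁ * algebraMap F K D = k₃ * algebraMap F K x := by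
    simp only [D, x, map_sub, map_mul]
    linear_combination algebraMap F K (s₂ 1) * h30 - algebraMap F K (s₂ 0) * h31
  have hy : k₂ * algebraMap F K D = k₃ * algebraMap F K y := by
    simp only [D, y, map_sub, map_mul]
    linear_combination algebraMap F K (s₁ 0) * h31 - algebraMap F K (s₁ 1) * h30
  have hdet' : k₁ * k₂ * algebraMap F K D ≠ 0 := by
    convert hdet using 1
    simp only [D, map_sub, map_mul]
    ring
  have hD' : algebraMap F K D ≠ 0 := right_ne_zero_of_mul hdet'
  have hk₁ : k₁ ≠ 0 := left_ne_zero_of_mul (left_ne_zero_of_mul hdet')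
  have hk₂ : k₂ ≠ 0 := right_ne_zero_of_mul (left_ne_zero_of_mul hdet')
  have hD : D ≠ 0 := fun h ↦ hD' (by rw [h, map_zero])
  have hx' := mul_ne_zero hk₁ hD'
  have hy' := mul_ne_zero hk₂ hD'
  rw [hx] at hx'
  rw [hy] at hy'
  have hk₃ := left_ne_zero_of_mul hx'
  have hx0 : x ≠ 0 := fun h ↦ hx' (by rw [h, map_zero, mul_zero])
  have hy0 : y ≠ 0 := fun h ↦ hy' (by rw [h, map_zero, mul_zero])
  let m : GL (Fin 2) F := Matrix.GeneralLinearGroup.mkOfDetNeZero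
    !![x * s₁ 0, y * s₂ 0; x * s₁ 1, y * s₂ 1] (by
      rw [Matrix.det_fin_two_of]
      convert mul_ne_zero (mul_ne_zero hx0 hy0) hD using 1
      simp only [D]
      ring)
  refine ⟨(Units.mk0 (k₃ / algebraMap F K D) (div_ne_zero hk₃ hD'), m), ?_⟩
  rw [← eq_div_iff hD'] at hx hy
  refine Units.ext ?_
  rw [coe_scaledMap]
  ext i j
  fin_cases i <;> fin_cases j <;>
    simp [m, Matrix.GeneralLinearGroup.mkOfDetNeZero, h10, h11, h20, h21, hx, hy] <;> ring

lemma frameSubline_mul_eq_iff {g h : GL (Fin 2) K} :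
    frameSubline F (g * h) = frameSubline F g ↔ h ∈ (scaledMap F K).range := by
  refine ⟨mem_range_scaledMap_of_frameSubline_eq, ?_⟩
  rintro ⟨x, rfl⟩
  exact frameSubline_mul_scaledMap g x

/-- The kernel consists of the pairs `(f⁻¹, f • 1)` with `f ∈ Fˣ`. -/
lemma card_ker_scaledMap : Nat.card (scaledMap F K).ker = Nat.card Fˣ := by
  symm
  refine Nat.card_congr (Equiv.ofBijective (fun f ↦ ⟨(Units.map (algebraMap F K).toMonoidHom f⁻¹,
    Matrix.GeneralLinearGroup.scalar (Fin 2) f), ?_⟩) ⟨?_, ?_⟩)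
  · rw [MonoidHom.mem_ker]
    refine Units.ext ?_
    rw [coe_scaledMap]
    ext i j
    fin_cases i <;> fin_cases j <;> simp [Matrix.GeneralLinearGroup.coe_scalar]
  · intro f f' h
    have := congrArg (fun x ↦ x.1.1.1) h
    simpa [Units.ext_iff] using this
  · rintro ⟨⟨k, m⟩, h⟩
    rw [MonoidHom.mem_ker] at h
    have h' (i j) : (k : K) * algebraMap F K (m.1 i j) = (1 : Matrix (Fin 2) (Fin 2) K) i j := by
      have := congrArg (fun A ↦ A.1 i j) h
      rw [coe_scaledMap] at this
      exact this
    have h00 := h' 0 0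
    have h01 := h' 0 1
    have h10 := h' 1 0
    have h11 := h' 1 1
    simp only [Matrix.one_apply_eq, Matrix.one_apply, Fin.isValue, zero_ne_one, one_ne_zero,
      if_false, mul_eq_zero, k.ne_zero, false_or, map_eq_zero] at h00 h01 h10 h11
    have hm0 : m.1 0 0 ≠ 0 := fun h ↦ by simp [h] at h00
    have hm1 : m.1 1 1 = m.1 0 0 := (algebraMap F K).injective <|
      mul_left_cancel₀ k.ne_zero (by rw [h00]; simpa using h11)
    refine ⟨Units.mk0 _ hm0, Subtype.ext (Prod.ext ?_ ?_)⟩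
    · ext
      simp [eq_inv_of_mul_eq_one_left h00]
    · ext i j
      fin_cases i <;> fin_cases j <;>
        simp [Matrix.GeneralLinearGroup.coe_scalar, h01, h10, hm1]

lemma card_range_scaledMap [Finite K] :
    Nat.card (scaledMap F K).range =
      (Nat.card K - 1) * (Nat.card F * (Nat.card F ^ 2 - 1)) := by
  have := Finite.of_injective _ (algebraMap F K).injective
  have := Fintype.ofFinite F
  have hpos : 0 < Nat.card F - 1 := Nat.sub_pos_of_lt Finite.one_lt_card
  have h := (scaledMap F K).ker.card_mul_index
  rw [Subgroup.index_ker, card_ker_scaledMap, Nat.card_prod, Nat.card_units, Nat.card_units,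
    Matrix.card_GL_field] at h
  refine Nat.eq_of_mul_eq_mul_left hpos ?_
  rw [h, Fin.prod_univ_two, Nat.card_eq_fintype_card (α := F)]
  simp only [Fin.val_zero, Fin.val_one, pow_zero, pow_one]
  have : Fintype.card F ^ 2 - Fintype.card F = Fintype.card F * (Fintype.card F - 1) := by
    rw [Nat.mul_sub, pow_two, mul_one]
  rw [this]
  ring

/-- The fibre through `g` is the left coset of `(scaledMap F K).range`. -/
lemma ncard_frameSubline_eq [Finite K] (g : GL (Fin 2) K) :
    {h : GL (Fin 2) K | frameSubline F h = frameSubline F g}.ncard =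
      (Nat.card K - 1) * (Nat.card F * (Nat.card F ^ 2 - 1)) := by
  rw [← card_range_scaledMap, ← SetLike.coe_sort_coe, Nat.card_coe_set_eq,
    ← Set.ncard_image_of_injective ((scaledMap F K).range : Set (GL (Fin 2) K))
      (mul_right_injective g)]
  congr 1
  ext h
  constructor
  · intro hh
    refine ⟨g⁻¹ * h, ?_, by simp⟩
    rw [SetLike.mem_coe, ← frameSubline_mul_eq_iff (g := g)]
    simpa using hh
  · rintro ⟨x, hx, rfl⟩
    exact frameSubline_mul_eq_iff.2 hx

lemma ncard_eq_ncard_image_mul {α β : Type*} {f : α → β} {s : Set α} (hs : s.Finite) {n : ℕ}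
    (h : ∀ a ∈ s, {b ∈ s | f b = f a}.ncard = n) : s.ncard = (f '' s).ncard * n := by
  classical
  lift s to Finset α using hs
  rw [← Finset.coe_image, Set.ncard_coe_finset, Set.ncard_coe_finset,
    Finset.card_eq_sum_card_image f s, Finset.sum_const_nat]
  intro b hb
  obtain ⟨a, ha, rfl⟩ := Finset.mem_image.1 hb
  rw [← h a ha, ← Set.ncard_coe_finset]
  simp

/-- Every subline is spanned by the same number of matrices. -/
lemma ncard_isSubline_subset_mul [Finite K] (S : Set (ℙ K (Fin 2 → K))) :
    {r : Set (ℙ K (Fin 2 → K)) | IsSubline F r ∧ r ⊆ S}.ncard *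
        ((Nat.card K - 1) * (Nat.card F * (Nat.card F ^ 2 - 1))) =
      {g : GL (Fin 2) K | frameSubline F g ⊆ S}.ncard := by
  rw [ncard_eq_ncard_image_mul (f := frameSubline F) (Set.toFinite _)]
  · congr 2
    ext r
    simp only [Set.mem_ofPred_eq, Set.mem_image, isSubline_iff_exists_frameSubline]
    constructor
    · rintro ⟨⟨g, rfl⟩, h⟩
      exact ⟨g, h, rfl⟩
    · rintro ⟨g, h, rfl⟩
      exact ⟨⟨g, rfl⟩, h⟩
  · intro g hg
    rw [← ncard_frameSubline_eq g]
    congr 1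
    ext h
    simp only [Set.mem_ofPred_eq, and_iff_right_iff_imp]
    rintro h
    rw [h]
    exact hg

end Frame

/-! ### Sublines inside a linear set of pseudoregulus type. -/

section Pseudoregulus

variable {F K : Type*} [Field F] [Field K] [Algebra F K]

/-- The coordinate ratio of `(x, x ^ q)` is `x ^ (q - 1)`, and by Hilbert 90 such powers are exactly
the elements of norm one. -/
lemma mk_mem_standardPseudoregulus_iff [Finite K] {v : Fin 2 → K} (hv : v ≠ 0) :
    Projectivization.mk K v hv ∈ standardPseudoregulus (Nat.card F) K ↔
      Algebra.norm F (v 0) = Algebra.norm F (v 1) := by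
  have := Finite.of_injective _ (algebraMap F K).injective
  have := Fintype.ofFinite F
  constructor
  · rintro ⟨x, h, -, hx⟩
    obtain ⟨a, rfl⟩ := (Projectivization.mk_eq_mk_iff' K _ _ _ _).1 hx
    simp [Nat.card_eq_fintype_card, FiniteField.pow_card]
  · intro h
    have h0 : v 0 = 0 ↔ v 1 = 0 := by
      rw [← Algebra.norm_eq_zero_iff (R := F), h, Algebra.norm_eq_zero_iff]
    have hv0 : v 0 ≠ 0 := fun h' ↦ hv (by
      ext i
      fin_cases i
      · exact h'
      · exact h0.1 h')
    have hv1 : v 1 ≠ 0 := mt h0.2 hv0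
    have hn : Algebra.norm F (v 1 / v 0) = 1 := by
      rw [← mul_left_inj' (mt (Algebra.norm_eq_zero_iff (R := F)).1 hv0), ← map_mul,
        div_mul_cancel₀ _ hv0, h, one_mul]
    obtain ⟨x, hx, hxv⟩ := (norm_eq_one_iff_exists_pow (div_ne_zero hv1 hv0)).1 hn
    have hne : ![x, x ^ Nat.card F] ≠ 0 := fun h ↦ hx (congrFun h 0)
    refine ⟨x, hne, hx, (Projectivization.mk_eq_mk_iff' K _ _ _ _).2 ⟨v 0 / x, ?_⟩⟩
    have hpow : x ^ Nat.card F = v 1 / v 0 * x := by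
      rw [← hxv, pow_sub_one_mul Nat.card_pos.ne']
    ext i
    fin_cases i
    · simp [hx]
    · change v 0 / x * x ^ Nat.card F = v 1
      rw [hpow]
      field_simp

lemma frameSubline_subset_standardPseudoregulus_iff [Finite K]
    (hK : Module.finrank F K ≤ Nat.card F) (g : GL (Fin 2) K) :
    frameSubline F g ⊆ standardPseudoregulus (Nat.card F) K ↔
      g.1 0 0 ≠ 0 ∧ Algebra.norm F (g.1 1 0) = Algebra.norm F (g.1 0 0) ∧
        IsConjRoot F (g.1 0 1 / g.1 0 0) (g.1 1 1 / g.1 1 0) := by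
  rw [frameSubline_subset_iff, ← norm_add_algebraMap_eq_iff hK]
  simp only [mk_mem_standardPseudoregulus_iff]
  have happ (s : Fin 2 → F) (i) : frameMap F g s i =
      g.1 i 0 * algebraMap F K (s 0) + g.1 i 1 * algebraMap F K (s 1) := by
    simp [frameMap_apply, Matrix.mulVec, dotProduct]
  have hdet := Matrix.GeneralLinearGroup.det_ne_zero g
  rw [Matrix.det_fin_two] at hdet
  constructor
  · intro h
    replace h (x y : F) : Algebra.norm F (g.1 0 0 * algebraMap F K x + g.1 0 1 * algebraMap F K y) =
        Algebra.norm F (g.1 1 0 * algebraMap F K x + g.1 1 1 * algebraMap F K y) := by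
      rcases eq_or_ne (frameMap F g ![x, y]) 0 with h0 | h0
      · have h00 := congrFun h0 0
        have h01 := congrFun h0 1
        rw [happ] at h00 h01
        simp only [Matrix.cons_val_zero, Matrix.cons_val_one, Pi.zero_apply] at h00 h01
        rw [h00, h01]
      · have := h _ h0
        rw [happ, happ] at this
        exact this
    have h10 := h 1 0
    simp only [map_one, mul_one, map_zero, mul_zero, add_zero] at h10
    have ha0 : g.1 0 0 = 0 ↔ g.1 1 0 = 0 := by
      rw [← Algebra.norm_eq_zero_iff (R := F), h10, Algebra.norm_eq_zero_iff]
    have ha : g.1 0 0 ≠ 0 := fun h0 ↦ hdet (by rw [ha0.1 h0, h0]; ring)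
    have hc := mt ha0.2 ha
    refine ⟨ha, h10.symm, fun s ↦ ?_⟩
    have hs := h s 1
    rw [map_one, mul_one, mul_one] at hs
    rw [← mul_right_inj' (mt (Algebra.norm_eq_zero_iff (R := F)).1 ha), ← map_mul]
    refine Eq.trans ?_ (congrArg (· * _) h10.symm)
    refine Eq.trans ?_ (map_mul _ _ _)
    convert hs using 2
    · field_simp
      ring
    · field_simp
      ring
  · rintro ⟨ha, hn, h⟩ s -
    have ha0 : g.1 0 0 = 0 ↔ g.1 1 0 = 0 := by
      rw [← Algebra.norm_eq_zero_iff (R := F), ← hn, Algebra.norm_eq_zero_iff]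
    have hc := mt ha0.2 ha
    rw [happ, happ]
    rcases eq_or_ne (s 1) 0 with hs | hs
    · simp [hs, hn]
    · have hs' : algebraMap F K (s 1) ≠ 0 := by simpa using hs
      -- Homogeneity: the case `s 1 ≠ 0` is the conjugacy condition at `s 0 / s 1`, rescaled by `N(a
      -- * s 1)`.
      have := congrArg (Algebra.norm F (g.1 0 0 * algebraMap F K (s 1)) * ·) (h (s 0 / s 1))
      beta_reduce at this
      rw [← map_mul, map_mul _ (g.1 0 0) (algebraMap F K (s 1)), ← hn, ← map_mul,
        ← map_mul] at this
      convert this using 2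
      · rw [map_div₀]
        field_simp
        ring
      · rw [map_div₀]
        field_simp
        ring

lemma ncard_isConjRoot_ne [Finite K] (u : K) :
    {v : K | IsConjRoot F u v ∧ v ≠ u}.ncard = Module.finrank F F⟮u⟯ - 1 := by
  rw [← ncard_isConjRoot, ← Set.ncard_sdiff_singleton_of_mem (show u ∈ {v | IsConjRoot F u v} from
    IsConjRoot.refl)]
  rfl

/-- Matrices spanning sublines of the standard linear set of pseudoregulus type correspond to
a first column with entries of equal norm, and a pair of distinct conjugate elements. -/
def frameSublineSubsetEquiv [Finite K] (hK : Module.finrank F K ≤ Nat.card F) :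
    {g : GL (Fin 2) K | frameSubline F g ⊆ standardPseudoregulus (Nat.card F) K} ≃
      (Σ a : Kˣ, {c : K | Algebra.norm F c = Algebra.norm F (a : K)}) ×
        (Σ u : K, {v : K | IsConjRoot F u v ∧ v ≠ u}) where
  toFun g :=
    have h := (frameSubline_subset_standardPseudoregulus_iff hK g.1).1 g.2
    (⟨Units.mk0 (g.1.1 0 0) h.1, g.1.1 1 0, h.2.1⟩,
      ⟨g.1.1 0 1 / g.1.1 0 0, g.1.1 1 1 / g.1.1 1 0, h.2.2, by
        have hdet := Matrix.GeneralLinearGroup.det_ne_zero g.1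
        rw [Matrix.det_fin_two] at hdet
        have hc : g.1.1 1 0 ≠ 0 := by
          rw [Ne, ← Algebra.norm_eq_zero_iff (R := F), h.2.1, Algebra.norm_eq_zero_iff]
          exact h.1
        rw [Ne, div_eq_div_iff hc h.1]
        intro h
        exact hdet (by linear_combination h)⟩)
  invFun x :=
    have ha := x.1.1.ne_zero
    have hc : (x.1.2.1 : K) ≠ 0 := by
      have h : Algebra.norm F (x.1.2.1 : K) = Algebra.norm F (x.1.1 : K) := x.1.2.2
      rw [Ne, ← Algebra.norm_eq_zero_iff (R := F), h, Algebra.norm_eq_zero_iff]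
      exact ha
    ⟨Matrix.GeneralLinearGroup.mkOfDetNeZero
      !![(x.1.1 : K), x.1.1 * x.2.1; x.1.2.1, x.1.2.1 * x.2.2.1] (by
        rw [Matrix.det_fin_two_of]
        -- The determinant is `a c (v - u)`.
        have := mul_ne_zero (mul_ne_zero ha hc) (sub_ne_zero.2 x.2.2.2.2)
        convert this using 1
        ring), by
      rw [Set.mem_ofPred_eq, frameSubline_subset_standardPseudoregulus_iff hK]
      refine ⟨ha, x.1.2.2, ?_⟩
      convert x.2.2.2.1 using 1
      · exact mul_div_cancel_left₀ _ ha
      · exact mul_div_cancel_left₀ _ hc⟩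
  left_inv g := by
    have h := (frameSubline_subset_standardPseudoregulus_iff hK g.1).1 g.2
    have hc : g.1.1 1 0 ≠ 0 := by
      rw [Ne, ← Algebra.norm_eq_zero_iff (R := F), h.2.1, Algebra.norm_eq_zero_iff]
      exact h.1
    refine Subtype.ext (Units.ext ?_)
    ext i j
    fin_cases i <;> fin_cases j
    · rfl
    · exact mul_div_cancel₀ _ h.1
    · rfl
    · exact mul_div_cancel₀ _ hc
  right_inv := by
    rintro ⟨⟨a, c, hac⟩, u, v, huv⟩
    have ha := a.ne_zero
    have hc : c ≠ 0 := by
      rw [Set.mem_ofPred_eq] at hac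
      rw [Ne, ← Algebra.norm_eq_zero_iff (R := F), hac, Algebra.norm_eq_zero_iff]
      exact ha
    refine Prod.ext ?_ ?_
    · refine Sigma.subtype_ext ?_ rfl
      exact Units.ext rfl
    · refine Sigma.subtype_ext ?_ ?_
      · exact mul_div_cancel_left₀ _ ha
      · exact mul_div_cancel_left₀ _ hc

lemma ncard_frameSubline_subset_standardPseudoregulus [Fintype K]
    (hK : Module.finrank F K ≤ Nat.card F) :
    {g : GL (Fin 2) K | frameSubline F g ⊆ standardPseudoregulus (Nat.card F) K}.ncard *
        (Nat.card F - 1) =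
      (Nat.card K - 1) * (Nat.card K - 1) * ∑ u : K, (Module.finrank F F⟮u⟯ - 1) := by
  classical
  rw [← Nat.card_coe_set_eq, Nat.card_congr (frameSublineSubsetEquiv hK), Nat.card_prod,
    Nat.card_sigma, Nat.card_sigma]
  simp only [Nat.card_coe_set_eq, ncard_isConjRoot_ne]
  rw [mul_right_comm, Finset.sum_mul, Finset.sum_congr rfl fun a _ ↦ ncard_norm_eq_norm a.ne_zero,
    Finset.sum_const, Finset.card_univ, ← Nat.card_eq_fintype_card, Nat.card_units, smul_eq_mul]

lemma exists_GL_mulVec_eq (g : (Fin 2 → K) ≃ₗ[K] (Fin 2 → K)) :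
    ∃ G : GL (Fin 2) K, ∀ v, G.1.mulVec v = g v :=
  ⟨⟨LinearMap.toMatrix' g.toLinearMap, LinearMap.toMatrix' g.symm.toLinearMap,
    by simp [← LinearMap.toMatrix'_comp], by simp [← LinearMap.toMatrix'_comp]⟩,
    fun v ↦ by simp [← Matrix.toLin'_apply]⟩

/-- Left multiplication by the matrix of `g` is a bijection between the two sets. -/
lemma ncard_frameSubline_subset_image [Finite K] (g : (Fin 2 → K) ≃ₗ[K] (Fin 2 → K))
    (S : Set (ℙ K (Fin 2 → K))) :
    {h : GL (Fin 2) K |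
        frameSubline F h ⊆ Projectivization.map g.toLinearMap g.injective '' S}.ncard =
      {h : GL (Fin 2) K | frameSubline F h ⊆ S}.ncard := by
  obtain ⟨G, hG⟩ := exists_GL_mulVec_eq g
  have key (h : GL (Fin 2) K) : frameSubline F (G * h) ⊆
      Projectivization.map g.toLinearMap g.injective '' S ↔ frameSubline F h ⊆ S := by
    rw [frameSubline_subset_iff, frameSubline_subset_iff]
    refine forall_congr' fun s ↦ ?_
    have hs : frameMap F (G * h) s = g (frameMap F h s) := by rw [frameMap_mul, hG]
    have hs' : frameMap F (G * h) s ≠ 0 ↔ frameMap F h s ≠ 0 := by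
      rw [hs, Ne, map_eq_zero_iff _ g.injective]
    have himg (h₁ : frameMap F (G * h) s ≠ 0) (h₂ : frameMap F h s ≠ 0) :
        Projectivization.mk K _ h₁ =
          Projectivization.map g.toLinearMap g.injective (Projectivization.mk K _ h₂) := by
      rw [Projectivization.map_mk]
      congr 1
    have hinj := Projectivization.map_injective g.toLinearMap (τ := RingHom.id K) g.injective
    constructor
    · intro H h₂
      rw [← hinj.mem_set_image, ← himg (hs'.2 h₂)]
      exact H _
    · intro H h₁
      rw [himg h₁ (hs'.1 h₁), hinj.mem_set_image]
      exact H _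
  rw [← Set.ncard_image_of_injective _ (mul_right_injective G⁻¹)]
  congr 1
  ext h
  constructor
  · rintro ⟨h', hh', rfl⟩
    rw [Set.mem_ofPred_eq, ← key]
    simpa using hh'
  · intro hh
    exact ⟨G * h, (key h).2 hh, by simp⟩

lemma finrank_adjoin_simple_algebraMap (x : F) :
    Module.finrank F F⟮algebraMap F K x⟯ = 1 :=
  IntermediateField.finrank_adjoin_simple_eq_one_iff.2 (IntermediateField.algebraMap_mem _ x)

/-- Elements of `F` have degree one and contribute zero; the other `Q - q` elements each lose one.
-/
lemma sum_finrank_adjoin_sub_one [Fintype K] :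
    ((∑ u : K, (Module.finrank F F⟮u⟯ - 1) : ℕ) : ℚ) =
      ∑ᶠ y ∈ (Set.range (algebraMap F K))ᶜ, (Module.finrank F F⟮y⟯ : ℚ) -
        (Nat.card K - Nat.card F) := by
  classical
  have := Finite.of_injective _ (algebraMap F K).injective
  have hpos (u : K) : 1 ≤ Module.finrank F F⟮u⟯ := Module.finrank_pos
  rw [finsum_mem_eq_toFinset_sum, Nat.cast_sum,
    ← Finset.sum_subset (Finset.subset_univ (Set.range (algebraMap F K))ᶜ.toFinset)]
  · rw [Finset.sum_congr rfl fun u _ ↦ Nat.cast_sub (hpos u), Finset.sum_sub_distrib,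
      Finset.sum_const, Set.toFinset_card, ← Nat.card_eq_fintype_card, Nat.card_coe_set_eq]
    have h1 := Set.ncard_add_ncard_compl (Set.range (algebraMap F K))
    rw [Set.ncard_range_of_injective (algebraMap F K).injective] at h1
    rw [← h1]
    simp
  · intro u _ hu
    simp only [Set.mem_toFinset, Set.mem_compl_iff, not_not] at hu
    obtain ⟨x, rfl⟩ := hu
    rw [finrank_adjoin_simple_algebraMap, Nat.sub_self, Nat.cast_zero]

lemma finsum_finrank_adjoin_of_prime [Finite K] (h : (Module.finrank F K).Prime) :
    ∑ᶠ y ∈ (Set.range (algebraMap F K))ᶜ, (Module.finrank F F⟮y⟯ : ℚ) =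
      Module.finrank F K * (Nat.card K - Nat.card F) := by
  classical
  have := Fintype.ofFinite K
  have hdeg (y : K) (hy : y ∈ (Set.range (algebraMap F K))ᶜ) :
      (Module.finrank F F⟮y⟯ : ℚ) = Module.finrank F K := by
    have hdvd : Module.finrank F F⟮y⟯ ∣ Module.finrank F K :=
      ⟨_, (Module.finrank_mul_finrank F F⟮y⟯ K).symm⟩
    rcases h.eq_one_or_self_of_dvd _ hdvd with h1 | h1
    · rw [IntermediateField.finrank_adjoin_simple_eq_one_iff, IntermediateField.mem_bot] at h1
      exact (hy h1).elim
    · rw [h1]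
  rw [finsum_mem_congr rfl hdeg, finsum_mem_eq_toFinset_sum, Finset.sum_const, Set.toFinset_card,
    ← Nat.card_eq_fintype_card, Nat.card_coe_set_eq]
  have h1 := Set.ncard_add_ncard_compl (Set.range (algebraMap F K))
  rw [Set.ncard_range_of_injective (algebraMap F K).injective] at h1
  rw [← h1]
  simp [mul_comm]

end Pseudoregulus

/-! ### Double counting and the closed formulas. -/

theorem theorem4 {F K : Type*} [Field F] [Finite F] [Field K] [Finite K] [Algebra F K]
    (q t : ℕ) (hq : Nat.card F = q) (ht : Module.finrank F K = t) (ht2 : 2 ≤ t) (hqt : t ≤ q)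
    (L : Set (ℙ K (Fin 2 → K))) (hL : IsPseudoregulusType F L) :
    ((Set.ncard {r : Set (ℙ K (Fin 2 → K)) | IsSubline F r ∧ r ⊆ L} : ℕ) : ℚ) =
        theta q (t - 1) / ((q : ℚ) + 1) *
          ((∑ᶠ y ∈ (Set.range (algebraMap F K))ᶜ, (Module.finrank F F⟮y⟯ : ℚ)) /
              ((q : ℚ) * ((q : ℚ) - 1)) - theta q (t - 2)) ∧
      (t.Prime →
        ((Set.ncard {r : Set (ℙ K (Fin 2 → K)) | IsSubline F r ∧ r ⊆ L} : ℕ) : ℚ) =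
          ((t : ℚ) - 1) * theta q (t - 1) * theta q (t - 2) / theta q 1) := by
  have := Fintype.ofFinite K
  obtain ⟨g, rfl⟩ := hL
  have hK : Nat.card K = q ^ t := by
    rw [Module.natCard_eq_pow_finrank (K := F) (V := K), hq, ht]
  have hA := ncard_isSubline_subset_mul (F := F)
    (Projectivization.map g.toLinearMap g.injective '' standardPseudoregulus (Nat.card F) K)
  rw [ncard_frameSubline_subset_image] at hA
  have hB := ncard_frameSubline_subset_standardPseudoregulus (F := F) (K := K)
    (by rw [ht, hq]; exact hqt)
  rw [← hA] at hB
  have hq1 : 1 < q := by omega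
  have hQ1 : 1 < q ^ t := Nat.one_lt_pow (by omega) hq1
  have hq2 : 1 ≤ q ^ 2 := Nat.one_le_pow _ _ (by omega)
  have hB' := congrArg (Nat.cast (R := ℚ)) hB
  rw [Nat.cast_mul, Nat.cast_mul, Nat.cast_mul, Nat.cast_mul, Nat.cast_mul, Nat.cast_mul,
    sum_finrank_adjoin_sub_one] at hB'
  have hp := finsum_finrank_adjoin_of_prime (F := F) (K := K)
  rw [ht] at hp
  rw [hK, hq] at hB' hp
  rw [hq]
  push_cast [Nat.cast_sub hQ1.le, Nat.cast_sub hq1.le, Nat.cast_sub hq2] at hB' hp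
  generalize (Set.ncard _ : ℚ) = n at hB' ⊢
  generalize ∑ᶠ y ∈ (Set.range (algebraMap F K))ᶜ, (Module.finrank F F⟮y⟯ : ℚ) = T at hB' hp ⊢
  -- Writing the degree as `t + 2` removes the truncated subtractions in the indices of `theta`.
  obtain ⟨t, rfl⟩ := Nat.exists_eq_add_of_le' ht2
  have hq1' : (q : ℚ) - 1 ≠ 0 := sub_ne_zero.2 (by exact_mod_cast hq1.ne')
  have hq0 : (q : ℚ) ≠ 0 := by exact_mod_cast (by omega : q ≠ 0)
  have hqp : (q : ℚ) + 1 ≠ 0 := by positivity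
  have hQ : (q : ℚ) ^ (t + 2) - 1 ≠ 0 := sub_ne_zero.2 (by exact_mod_cast hQ1.ne')
  have hn : n = theta q (t + 2 - 1) / ((q : ℚ) + 1) *
      (T / ((q : ℚ) * ((q : ℚ) - 1)) - theta q (t + 2 - 2)) := by
    simp only [theta, Nat.add_sub_cancel, show t + 2 - 1 = t + 1 by omega, add_assoc]
    norm_num only
    have hB'' : n * (q * ((q : ℚ) ^ 2 - 1)) * (q - 1) =
        ((q : ℚ) ^ (t + 2) - 1) * (T - ((q : ℚ) ^ (t + 2) - q)) :=
      -- One factor `Q - 1` from the choice of `a` cancels against the scalars `Kˣ` in the fibre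
      -- size.
      mul_left_cancel₀ hQ (by linear_combination hB')
    field_simp
    linear_combination hB''
  refine ⟨hn, fun htp ↦ ?_⟩
  rw [hn, hp htp]
  simp only [theta, Nat.add_sub_cancel, show t + 2 - 1 = t + 1 by omega, add_assoc]
  norm_num only
  have hq1'' : (q : ℚ) ^ 2 - 1 ≠ 0 := by
    rw [show (q : ℚ) ^ 2 - 1 = (q - 1) * (q + 1) by ring]
    exact mul_ne_zero hq1' hqp
  push_cast
  field_simp
  ring
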